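/- Let $T\ge 0$ and let $X=(X_t)_{0\le t\le T}$ be a one-dimensional analytic affine process with state space $D=\mathbb R$ or $D=\mathbb R_{\ge 0}$: $X$ is a time-homogeneous, stochastically continuous Markov process with laws $(\mathbb P^x)_{x\in D}$, $\mathbb P^x(X_0=x)=1$, such that for $0\le t\le T$ and $u\in i\mathbb R$ there are $\phi_t(u),\psi_t(u)\in\mathbb C$ with $\mathbb E^x[e^{uX_t}]=e^{\phi_t(u)+\psi_t(u)x}$ for all $x\in D$, and $0$ is an interior point of $$\mathcal V=\Big\{u\in\mathbb C:\ \sup_{0\le s\le T}\mathbb E^x\big[e^{\mathrm{Re}(u)X_s}\big]<\infty\ \text{ for all } x\in D\Big\}.$$ For real $u\in\mathcal V$ let $\phi_t(u),\psi_t(u)$ be the real numbers with $\mathbb E^x[e^{uX_t}]=e^{\phi_t(u)+\psi_t(u)x}$ for all $x\in D$. For $0\le t\le T$ and real $u$ with $u,-u\in\mathcal V$ define $$M_t^u(x)=\tfrac12\Big(e^{\phi_{T-t}(u)+\psi_{T-t}(u)x}+e^{\phi_{T-t}(-u)+\psi_{T-t}(-u)x}\Big),\qquad x\in\mathbb R.$$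 Fix $t\in[0,T]$ and let $u_0,u_1,\dots,u_n$ be real numbers with $\pm u_i\in\mathcal V$ for $i=0,\dots,n$, such that $u_0\ge u_i\ge 0$ for $i=1,\dots,n$ and $u_0>u_i$ for at least one $i$. Let $c_1,\dots,c_n>0$ and define $$g:\mathbb R\to\mathbb R,\qquad g(x)=\sum_{i=1}^n c_i\,\frac{M_t^{u_i}(x)}{M_t^{u_0}(x)}.$$ Then there is a point $\xi\in\mathbb R$ such that $g(x)<g(\xi)$ for all $x\ne\xi$ (so $g$ has a unique maximum, attained at $\xi$), $g$ is strictly increasing on $(-\infty,\xi]$ and strictly decreasing on $[\xi,\infty)$, and $$\lim_{x\to-\infty}g(x)=\lim_{x\to\infty}g(x)=\sum_{i\,:\,u_i=u_0}c_i .$$ In particular, if $u_i<u_0$ for all $i=1,\dots,n$, then $g$ decreases strictly to $0$ on both sides of $\xi$. -/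

import Mathlib

open Set Filter Topology MeasureTheory ProbabilityTheory
open scoped NNReal ENNReal

namespace AffineLibor

/-- `X` is a time-homogeneous (conservative) Markov process with state space `D ⊆ ℝ` on the time
interval `[0, T]`, adapted to the filtration `𝓕`; `P x` is the law under which it starts in `x`.
Only times `t ≤ T` matter; values of `X` and `𝓕` at later times are never used. -/
structure IsMarkovProcess {Ω : Type*} {mΩ : MeasurableSpace Ω} {D : Set ℝ} (T : ℝ≥0)
    (𝓕 : Filtration ℝ≥0 mΩ) (X : ℝ≥0 → Ω → D) (P : Kernel D Ω) : Prop where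
  isMarkovKernel : IsMarkovKernel P
  adapted : ∀ t ≤ T, Measurable[𝓕 t] (X t)
  initial : ∀ x : D, ∀ᵐ ω ∂(P x), X 0 ω = x
  markov : ∀ (x : D) (s t : ℝ≥0), s + t ≤ T → ∀ A : Set D, MeasurableSet A →
    (P x)[(X (s + t) ⁻¹' A).indicator (fun _ => (1 : ℝ)) | 𝓕 s]
      =ᵐ[P x] fun ω => (P (X s ω)).real (X t ⁻¹' A)

/-- The characteristic function of `X t` under `P x` is the exponential of an affine function of the
starting point `x`: `𝔼ˣ[exp (u X_t)] = exp (φ_t(u) + ψ_t(u) x)` for all `u ∈ iℝ`, `x ∈ D`. -/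
def IsAffine {Ω : Type*} {mΩ : MeasurableSpace Ω} {D : Set ℝ} (T : ℝ≥0)
    (X : ℝ≥0 → Ω → D) (P : Kernel D Ω) : Prop :=
  ∃ φ ψ : ℝ≥0 → ℂ → ℂ, ∀ t ≤ T, ∀ u : ℂ, u.re = 0 → ∀ x : D,
    ∫ ω, Complex.exp (u * ((X t ω : ℝ) : ℂ)) ∂(P x)
      = Complex.exp (φ t u + ψ t u * ((x : ℝ) : ℂ))

/-- The set `𝒱` of all `u ∈ ℂ` with `sup_{0 ≤ s ≤ T} 𝔼ˣ[exp (Re(u) X_s)] < ∞` for all `x ∈ D`. -/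
def momentSet {Ω : Type*} {mΩ : MeasurableSpace Ω} {D : Set ℝ} (T : ℝ≥0)
    (X : ℝ≥0 → Ω → D) (P : Kernel D Ω) : Set ℂ :=
  {u | ∀ x : D,
    (⨆ s ∈ Set.Iic T, ∫⁻ ω, ENNReal.ofReal (Real.exp (u.re * (X s ω : ℝ))) ∂(P x)) < ⊤}

/-- One-dimensional analytic affine processes on `[0, T]`: affine Markov processes with state space
`ℝ` or `[0, ∞)` that are stochastically continuous and for which `0` is an interior point of the
set `𝒱`. -/
structure IsAnalyticAffine {Ω : Type*} {mΩ : MeasurableSpace Ω} {D : Set ℝ} (T : ℝ≥0)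
    (𝓕 : Filtration ℝ≥0 mΩ) (X : ℝ≥0 → Ω → D) (P : Kernel D Ω) : Prop where
  stateSpace : D = Set.univ ∨ D = Set.Ici 0
  markovProcess : IsMarkovProcess T 𝓕 X P
  affine : IsAffine T X P
  stochasticallyContinuous : ∀ x : D, ∀ t ≤ T, TendstoInMeasure (P x) X (𝓝[Set.Iic T] t) (X t)
  zero_mem_interior : (0 : ℂ) ∈ interior (momentSet T X P)

/-- For real `u ∈ 𝒱`: the pair `(φ_t(u), ψ_t(u))` of real numbers which satisfies
`𝔼ˣ[exp (u X_t)] = exp (φ_t(u) + ψ_t(u) x)` for all `x ∈ D`. At real points these are the values of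
the continuous extensions to `𝒱` of the two functions in `IsAffine` (normalized by `φ_t(0) = 0`).
The pair is unique, see `exponents_eq`. -/
noncomputable def exponents {Ω : Type*} {mΩ : MeasurableSpace Ω} {D : Set ℝ}
    (X : ℝ≥0 → Ω → D) (P : Kernel D Ω) (t : ℝ≥0) (u : ℝ) : ℝ × ℝ :=
  Classical.epsilon fun p : ℝ × ℝ => ∀ x : D,
    ∫ ω, Real.exp (u * (X t ω : ℝ)) ∂(P x) = Real.exp (p.1 + p.2 * (x : ℝ))

theorem exponents_eq {Ω : Type*} {mΩ : MeasurableSpace Ω} {D : Set ℝ}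
    (hD : D = Set.univ ∨ D = Set.Ici 0) (X : ℝ≥0 → Ω → D) (P : Kernel D Ω) (t : ℝ≥0) (u : ℝ)
    (p : ℝ × ℝ) (hp : ∀ x : D,
      ∫ ω, Real.exp (u * (X t ω : ℝ)) ∂(P x) = Real.exp (p.1 + p.2 * (x : ℝ))) :
    exponents X P t u = p := by
  have hq : ∀ x : D, ∫ ω, Real.exp (u * (X t ω : ℝ)) ∂(P x)
      = Real.exp ((exponents X P t u).1 + (exponents X P t u).2 * (x : ℝ)) :=
    Classical.epsilon_spec (p := fun p : ℝ × ℝ => ∀ x : D,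
      ∫ ω, Real.exp (u * (X t ω : ℝ)) ∂(P x) = Real.exp (p.1 + p.2 * (x : ℝ))) ⟨p, hp⟩
  have h0 : (0 : ℝ) ∈ D := by rcases hD with h | h <;> simp [h]
  have h1 : (1 : ℝ) ∈ D := by rcases hD with h | h <;> simp [h]
  have e0 := Real.exp_injective ((hq ⟨0, h0⟩).symm.trans (hp ⟨0, h0⟩))
  have e1 := Real.exp_injective ((hq ⟨1, h1⟩).symm.trans (hp ⟨1, h1⟩))
  simp only [mul_zero, add_zero, mul_one] at e0 e1
  exact Prod.ext e0 (by linarith)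

/-- `φ_t(u)` for real `u`. -/
noncomputable def phi {Ω : Type*} {mΩ : MeasurableSpace Ω} {D : Set ℝ}
    (X : ℝ≥0 → Ω → D) (P : Kernel D Ω) (t : ℝ≥0) (u : ℝ) : ℝ :=
  (exponents X P t u).1

/-- `ψ_t(u)` for real `u`. -/
noncomputable def psi {Ω : Type*} {mΩ : MeasurableSpace Ω} {D : Set ℝ}
    (X : ℝ≥0 → Ω → D) (P : Kernel D Ω) (t : ℝ≥0) (u : ℝ) : ℝ :=
  (exponents X P t u).2

/-- The function `x ↦ M_t^u(x)` on all of `ℝ`, for `t ≤ T`. -/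
noncomputable def M {Ω : Type*} {mΩ : MeasurableSpace Ω} {D : Set ℝ} (T : ℝ≥0)
    (X : ℝ≥0 → Ω → D) (P : Kernel D Ω) (t : ℝ≥0) (u x : ℝ) : ℝ :=
  1 / 2 * (Real.exp (phi X P (T - t) u + psi X P (T - t) u * x)
    + Real.exp (phi X P (T - t) (-u) + psi X P (T - t) (-u) * x))

/-- The function `g(x) = ∑ᵢ cᵢ M_t^{uᵢ}(x) / M_t^{u₀}(x)`. -/
noncomputable def g {Ω : Type*} {mΩ : MeasurableSpace Ω} {D : Set ℝ} (T : ℝ≥0)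
    (X : ℝ≥0 → Ω → D) (P : Kernel D Ω) (t : ℝ≥0) {n : ℕ} (u₀ : ℝ) (u c : Fin n → ℝ) (x : ℝ) : ℝ :=
  ∑ i, c i * (M T X P t (u i) x / M T X P t u₀ x)

end AffineLibor

namespace AffineLibor

/-! Each quotient in `g` divides one pair of exponentials by another. With slopes `a = ψ(uᵢ)`, `b =
ψ(-uᵢ)` above and `a' = ψ(u₀)`, `b' = ψ(-u₀)` below, suppose `b' < b ≤ a < a'`. Then the derivative
of the quotient is a positive weight depending only on the denominator, times a sum of four
exponentials each of which is strictly decreasing. The common weight survives positive combinations,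
so the derivative of the sum changes sign at most once; as the sum is positive and tends to 0 at
both ends, it has a maximum and is unimodal (`exists_unimodal_sum_expPair_div`). Indices with `uᵢ =
u₀` only add constants.

It remains to see that `ψ_s` is strictly increasing on `[-u₀, u₀]` (`psi_strictMonoOn`).
Characteristic functions give convolution identities between the laws of `X_s` from different
starting points, so finite moments are exponentials of affine functions of the start
(`expMoment_eq`). If `ψ_s` is constant on an interval, analytic continuation shows that the law of
`X_s` does not depend on the start. Otherwise `ψ_s` is strictly increasing: on `[0, ∞)` because it
is monotone, on `ℝ` because it is linear and the semiflow property makes its slope a square.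
Independence of the start would pass from `s` to `s / 2`, hence to arbitrarily small times, against
stochastic continuity at time 0. -/

/-! ### Calculus of quotients of exponential pairs. -/

/-- The average of the exponentials of the two affine functions `p + a x` and `q + b x`. -/
noncomputable def expPair (p a q b x : ℝ) : ℝ :=
  1 / 2 * (Real.exp (p + a * x) + Real.exp (q + b * x))

theorem expPair_pos (p a q b x : ℝ) : 0 < expPair p a q b x := by
  unfold expPair; positivity

theorem hasDerivAt_exp_affine (p a x : ℝ) :
    HasDerivAt (fun x => Real.exp (p + a * x)) (Real.exp (p + a * x) * a) x := by
  have h : HasDerivAt (fun x => p + a * x) a x := by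
    simpa using ((hasDerivAt_id x).const_mul a).const_add p
  exact h.exp

theorem hasDerivAt_expPair (p a q b x : ℝ) :
    HasDerivAt (expPair p a q b)
      (1 / 2 * (Real.exp (p + a * x) * a + Real.exp (q + b * x) * b)) x :=
  ((hasDerivAt_exp_affine p a x).add (hasDerivAt_exp_affine q b x)).const_mul _

/-- Up to a positive factor, the derivative of a quotient of two `expPair`s. -/
noncomputable def ratioSlope (p a q b p' a' q' b' x : ℝ) : ℝ :=
  -((a' - a) * Real.exp ((p - q') + (a - b') * x)) + (a - b') * Real.exp ((p - p') + (a - a') * x)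
    - (a' - b) * Real.exp ((q - q') + (b - b') * x) + (b - b') * Real.exp ((q - p') + (b - a') * x)

/-- The positive factor that relates `ratioSlope` to the derivative of the quotient. -/
noncomputable def ratioWeight (p' a' q' b' x : ℝ) : ℝ :=
  1 / 4 * (Real.exp (p' + a' * x) * Real.exp (q' + b' * x)) / expPair p' a' q' b' x ^ 2

theorem ratioWeight_pos (p' a' q' b' x : ℝ) : 0 < ratioWeight p' a' q' b' x := by
  have := expPair_pos p' a' q' b' x
  unfold ratioWeight; positivity

theorem hasDerivAt_expPair_div (p a q b p' a' q' b' x : ℝ) :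
    HasDerivAt (fun x => expPair p a q b x / expPair p' a' q' b' x)
      (ratioWeight p' a' q' b' x * ratioSlope p a q b p' a' q' b' x) x := by
  have hpos := expPair_pos p' a' q' b' x
  refine ((hasDerivAt_expPair p a q b x).div (hasDerivAt_expPair p' a' q' b' x)
    hpos.ne').congr_deriv (Eq.symm ?_)
  have e (r s r' s' : ℝ) :
      Real.exp ((r - r') + (s - s') * x) = Real.exp (r + s * x) / Real.exp (r' + s' * x) := by
    rw [← Real.exp_sub]; congr 1; ring
  rw [ratioWeight, ratioSlope, e, e, e, e, div_mul_eq_mul_div]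
  congr 1
  have h1 := (Real.exp_pos (p' + a' * x)).ne'
  have h2 := (Real.exp_pos (q' + b' * x)).ne'
  unfold expPair
  field_simp
  ring

/-- In each of the four terms the coefficient and the exponential rate have opposite signs, so every
term decreases strictly. -/
theorem strictAnti_ratioSlope {p a q b p' a' q' b' : ℝ} (hb : b' < b) (hba : b ≤ a)
    (ha : a < a') : StrictAnti (ratioSlope p a q b p' a' q' b') := by
  intro x y hxy
  have up {k r : ℝ} (hk : 0 < k) : Real.exp (r + k * x) < Real.exp (r + k * y) := by
    gcongr
  have down {k r : ℝ} (hk : k < 0) : Real.exp (r + k * y) < Real.exp (r + k * x) := by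
    have := mul_lt_mul_of_neg_left hxy hk
    gcongr
  have m {k s t : ℝ} (hk : 0 < k) (h : s < t) : k * s < k * t := by gcongr
  have h1 := m (sub_pos.2 ha) (up (k := a - b') (r := p - q') (by linarith))
  have h2 := m (k := a - b') (by linarith) (down (k := a - a') (r := p - p') (by linarith))
  have h3 := m (k := a' - b) (by linarith) (up (k := b - b') (r := q - q') (by linarith))
  have h4 := m (sub_pos.2 hb) (down (k := b - a') (r := q - p') (by linarith))
  unfold ratioSlope
  linarith

theorem tendsto_exp_affine_atTop {r k : ℝ} (hk : k < 0) :
    Tendsto (fun x => Real.exp (r + k * x)) atTop (𝓝 0) :=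
  Real.tendsto_exp_atBot.comp
    (tendsto_atBot_add_const_left _ _ (tendsto_id.const_mul_atTop_of_neg hk))

theorem tendsto_expPair_div_atTop {p a q b p' a' q' b' : ℝ} (hba : b ≤ a) (ha : a < a') :
    Tendsto (fun x => expPair p a q b x / expPair p' a' q' b' x) atTop (𝓝 0) := by
  have h := (tendsto_exp_affine_atTop (r := p - p') (sub_neg.2 ha)).add
    (tendsto_exp_affine_atTop (r := q - p') (sub_neg.2 (hba.trans_lt ha)))
  rw [add_zero] at h
  -- Dropping the `q'` exponential from the denominator bounds the quotient by two decaying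
  -- exponentials.
  refine squeeze_zero (fun x => (div_pos (expPair_pos ..) (expPair_pos ..)).le) (fun x => ?_) h
  rw [div_le_iff₀ (expPair_pos ..)]
  have e (r s : ℝ) : Real.exp ((r - p') + (s - a') * x) * Real.exp (p' + a' * x)
      = Real.exp (r + s * x) := by
    rw [← Real.exp_add]; congr 1; ring
  have h1 := e p a
  have h2 := e q b
  have h3 : 0 < (Real.exp (p - p' + (a - a') * x) + Real.exp (q - p' + (b - a') * x))
    * Real.exp (q' + b' * x) := by positivity
  unfold expPair
  linarith

/-- Reflection swaps the two exponentials and negates the slopes, which reduces the limit at `-∞` to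
the one at `+∞`. -/
theorem expPair_neg (p a q b x : ℝ) : expPair p a q b (-x) = expPair q (-b) p (-a) x := by
  simp only [expPair, mul_neg, neg_mul, add_comm]

theorem tendsto_expPair_div_atBot {p a q b p' a' q' b' : ℝ} (hb : b' < b) (hba : b ≤ a) :
    Tendsto (fun x => expPair p a q b x / expPair p' a' q' b' x) atBot (𝓝 0) := by
  have h := (tendsto_expPair_div_atTop (p := q) (q := p) (p' := q') (q' := p') (b' := -a')
    (neg_le_neg hba) (neg_lt_neg hb)).comp tendsto_neg_atBot_atTop
  refine h.congr fun x => ?_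
  simp only [Function.comp, ← expPair_neg, neg_neg]

/-- A positive combination of quotients of `expPair`s by a dominating one is unimodal. -/
theorem exists_unimodal_sum_expPair_div {ι : Type*} (S : Finset ι) (hS : S.Nonempty)
    (c p a q b : ι → ℝ) (p' a' q' b' : ℝ) (hc : ∀ i ∈ S, 0 < c i) (hb : ∀ i ∈ S, b' < b i)
    (hba : ∀ i ∈ S, b i ≤ a i) (ha : ∀ i ∈ S, a i < a') :
    let G : ℝ → ℝ :=
      fun x => ∑ i ∈ S, c i * (expPair (p i) (a i) (q i) (b i) x / expPair p' a' q' b' x)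
    (∃ ξ, StrictMonoOn G (Iic ξ) ∧ StrictAntiOn G (Ici ξ)) ∧
      Tendsto G atBot (𝓝 0) ∧ Tendsto G atTop (𝓝 0) := by
  intro G
  -- The weight does not involve the numerators, so it factors out of the derivative of the sum and
  -- leaves the strictly decreasing `d`.
  let d : ℝ → ℝ := fun x => ∑ i ∈ S, c i * ratioSlope (p i) (a i) (q i) (b i) p' a' q' b' x
  have hG (x : ℝ) : HasDerivAt G (ratioWeight p' a' q' b' x * d x) x := by
    refine (HasDerivAt.fun_sum fun i (_ : i ∈ S) =>
      (hasDerivAt_expPair_div (p i) (a i) (q i) (b i) p' a' q' b' x).const_mul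
        (c i)).congr_deriv (Eq.symm ?_)
    simp only [d, Finset.mul_sum]
    exact Finset.sum_congr rfl fun i _ => by ring
  have hd : StrictAnti d := fun x y hxy => Finset.sum_lt_sum_of_nonempty hS fun i hi =>
    mul_lt_mul_of_pos_left (strictAnti_ratioSlope (hb i hi) (hba i hi) (ha i hi) hxy) (hc i hi)
  have hcont : Continuous G := continuous_iff_continuousAt.2 fun x => (hG x).continuousAt
  have hbot : Tendsto G atBot (𝓝 0) := by
    simpa using tendsto_finsetSum S fun i hi =>
      (tendsto_expPair_div_atBot (p := p i) (q := q i) (p' := p') (q' := q') (a' := a')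
        (hb i hi) (hba i hi)).const_mul (c i)
  have htop : Tendsto G atTop (𝓝 0) := by
    simpa using tendsto_finsetSum S fun i hi =>
      (tendsto_expPair_div_atTop (p := p i) (q := q i) (p' := p') (q' := q') (b' := b')
        (hba i hi) (ha i hi)).const_mul (c i)
  refine ⟨?_, hbot, htop⟩
  have hpos : 0 < G 0 := Finset.sum_pos (fun i hi => mul_pos (hc i hi)
    (div_pos (expPair_pos ..) (expPair_pos ..))) hS
  -- Outside a compact set `G` stays below `G 0 > 0`, so a global maximum exists; it is the zero of
  -- `d`.
  obtain ⟨ξ, hξ⟩ := hcont.exists_forall_ge' 0 (by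
    rw [cocompact_eq_atBot_atTop, eventually_sup]
    exact ⟨(hbot.eventually_lt_const hpos).mono fun _ h => h.le,
      (htop.eventually_lt_const hpos).mono fun _ h => h.le⟩)
  have hdξ : d ξ = 0 := by
    have := (IsLocalMax.hasDerivAt_eq_zero (Eventually.of_forall hξ) (hG ξ))
    exact (mul_eq_zero.1 this).resolve_left (ratioWeight_pos ..).ne'
  refine ⟨ξ, ?_, ?_⟩
  · refine strictMonoOn_of_deriv_pos (convex_Iic ξ) hcont.continuousOn fun x hx => ?_
    rw [interior_Iic] at hx
    rw [(hG x).deriv]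
    exact mul_pos (ratioWeight_pos ..) (hdξ ▸ hd hx)
  · refine strictAntiOn_of_deriv_neg (convex_Ici ξ) hcont.continuousOn fun x hx => ?_
    rw [interior_Ici] at hx
    rw [(hG x).deriv]
    exact mul_neg_of_pos_of_neg (ratioWeight_pos ..) (hdξ ▸ hd hx)

/-! ### Cauchy's functional equation on the state space. -/

/-- An additive function on a half-line or on the line that is measurable is linear. -/
theorem exists_linear_of_additive_measurable {D : Set ℝ} (hD : D = univ ∨ D = Ici 0) (h : D → ℝ)
    (hm : Measurable h)
    (hadd : ∀ x y z : D, (x : ℝ) + y = z → h x + h y = h z) :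
    ∃ b : ℝ, ∀ x : D, h x = b * x := by
  have hmem {x : ℝ} (hx : 0 ≤ x) : x ∈ D := by rcases hD with rfl | rfl <;> simp [hx]
  -- `e` is the positive part. The difference `h(x⁺) - h(x⁻)` extends `h` to an additive map on all
  -- of `ℝ`, to which automatic continuity of measurable homomorphisms applies.
  let e : ℝ → D := fun x => ⟨max x 0, hmem (le_max_right _ _)⟩
  have he : Measurable e := (measurable_id.max measurable_const).subtype_mk
  have hadd' (x y : ℝ) : h (e (x + y)) - h (e (-(x + y)))
      = (h (e x) - h (e (-x))) + (h (e y) - h (e (-y))) := by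
    have pos (x : ℝ) : ∀ {y : ℝ}, 0 ≤ x → 0 ≤ y →
        h (e x) + h (e y) = h (e (x + y)) := fun {y} hx hy =>
      hadd _ _ _ (by simp [e, hx, hy, add_nonneg])
    have e_max (x : ℝ) : e (max x 0) = e x := by simp [e]
    have h1 := pos (max x 0) (le_max_right _ _) (le_max_right y 0)
    have h2 := pos (max (-x) 0) (le_max_right _ _) (le_max_right (-y) 0)
    have h3 := pos (max (x + y) 0) (le_max_right _ _)
      (add_nonneg (le_max_right (-x) 0) (le_max_right (-y) 0))
    have h4 := pos (max (-(x + y)) 0) (le_max_right _ _)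
      (add_nonneg (le_max_right x 0) (le_max_right y 0))
    -- Both sides are sums of nonnegative numbers, where additivity of `h` is available; equating
    -- them gives additivity of the extension.
    have h5 : max (x + y) 0 + (max (-x) 0 + max (-y) 0)
        = max (-(x + y)) 0 + (max x 0 + max y 0) := by
      have m (z : ℝ) : max z 0 - max (-z) 0 = z := by
        rcases le_total 0 z with hz | hz <;> simp [hz]
      linarith [m x, m y, m (x + y)]
    rw [h5] at h3
    simp only [e_max] at h1 h2 h3 h4
    linarith
  let k : ℝ →+ ℝ := AddMonoidHom.mk' (fun x => h (e x) - h (e (-x))) hadd'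
  have hk : Continuous k := MeasureTheory.Measure.AddMonoidHom.continuous_of_measurable k
    ((hm.comp he).sub (hm.comp (he.comp measurable_neg)))
  refine ⟨k 1, fun x => ?_⟩
  have h1 : k x = k 1 * x := by
    have := map_real_smul k hk (x : ℝ) 1
    simpa [mul_comm] using this
  rw [← h1]
  change h x = h (e x) - h (e (-x))
  have := hadd x (e (-x)) (e x) (by
    rcases le_total 0 (x : ℝ) with hz | hz <;> simp [e, hz])
  linarith

/-! ### Laws, exponential moments and their affine form. -/

section

variable {Ω : Type*} {mΩ : MeasurableSpace Ω} {D : Set ℝ} {T : ℝ≥0} {𝓕 : Filtration ℝ≥0 mΩ}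
  {X : ℝ≥0 → Ω → D} {P : Kernel D Ω}

/-- The moment `𝔼ˣ[exp (u X_s)]` as an extended nonnegative real. -/
noncomputable def expMoment (X : ℝ≥0 → Ω → D) (P : Kernel D Ω) (s : ℝ≥0) (u : ℝ) (x : D) : ℝ≥0∞ :=
  ∫⁻ ω, ENNReal.ofReal (Real.exp (u * (X s ω : ℝ))) ∂(P x)

/-- The law of `X_s` under `ℙˣ`. -/
noncomputable def law (X : ℝ≥0 → Ω → D) (P : Kernel D Ω) (s : ℝ≥0) (x : D) : Measure ℝ :=
  (P x).map fun ω => (X s ω : ℝ)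

theorem IsAnalyticAffine.measurable (hX : IsAnalyticAffine T 𝓕 X P) {s : ℝ≥0} (hs : s ≤ T) :
    Measurable (X s) :=
  (hX.markovProcess.adapted s hs).mono (𝓕.le s) le_rfl

theorem IsAnalyticAffine.measurable_coe (hX : IsAnalyticAffine T 𝓕 X P) {s : ℝ≥0} (hs : s ≤ T) :
    Measurable fun ω => (X s ω : ℝ) :=
  measurable_subtype_coe.comp (hX.measurable hs)

theorem IsAnalyticAffine.isProbabilityMeasure_law (hX : IsAnalyticAffine T 𝓕 X P) {s : ℝ≥0}
    (hs : s ≤ T) (x : D) : IsProbabilityMeasure (law X P s x) := by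
  have := hX.markovProcess.isMarkovKernel
  exact Measure.isProbabilityMeasure_map (hX.measurable_coe hs).aemeasurable

theorem measurable_ofReal_exp_mul (u : ℝ) :
    Measurable fun y : ℝ => ENNReal.ofReal (Real.exp (u * y)) := by fun_prop

theorem IsAnalyticAffine.measurable_ofReal_exp (hX : IsAnalyticAffine T 𝓕 X P) {s : ℝ≥0}
    (hs : s ≤ T) (u : ℝ) :
    Measurable fun ω => ENNReal.ofReal (Real.exp (u * (X s ω : ℝ))) :=
  (measurable_ofReal_exp_mul u).comp (hX.measurable_coe hs)

theorem IsAnalyticAffine.expMoment_eq_lintegral_law (hX : IsAnalyticAffine T 𝓕 X P) {s : ℝ≥0}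
    (hs : s ≤ T) (u : ℝ) (x : D) :
    expMoment X P s u x = ∫⁻ y, ENNReal.ofReal (Real.exp (u * y)) ∂(law X P s x) :=
  (lintegral_map (measurable_ofReal_exp_mul u) (hX.measurable_coe hs)).symm

theorem IsAnalyticAffine.measurable_expMoment (hX : IsAnalyticAffine T 𝓕 X P) {s : ℝ≥0}
    (hs : s ≤ T) (u : ℝ) : Measurable (expMoment X P s u) :=
  (hX.measurable_ofReal_exp hs u).lintegral_kernel

/-- The product of the two characteristic functions depends on the starting points only through
their sum. -/
theorem IsAnalyticAffine.law_conv_eq (hX : IsAnalyticAffine T 𝓕 X P) {s : ℝ≥0} (hs : s ≤ T)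
    {x y x' y' : D} (h : (x : ℝ) + y = x' + y') :
    law X P s x ∗ law X P s y = law X P s x' ∗ law X P s y' := by
  have := hX.isProbabilityMeasure_law hs
  obtain ⟨φ, ψ, hφ⟩ := hX.affine
  refine Measure.ext_of_charFun (funext fun r => ?_)
  have hc (x : D) : charFun (law X P s x) r
      = Complex.exp (φ s (r * Complex.I) + ψ s (r * Complex.I) * ((x : ℝ) : ℂ)) := by
    rw [charFun_apply_real, law, integral_map (hX.measurable_coe hs).aemeasurable
      (by fun_prop), ← hφ s hs _ (by simp)]
    congr 1; ext ω; congr 1; ring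
  have h' : ((x : ℝ) : ℂ) + ((y : ℝ) : ℂ) = ((x' : ℝ) : ℂ) + ((y' : ℝ) : ℂ) := by exact_mod_cast h
  rw [charFun_conv, charFun_conv, hc, hc, hc, hc, ← Complex.exp_add, ← Complex.exp_add]
  congr 1
  linear_combination (ψ s (r * Complex.I)) * h'

theorem lintegral_exp_conv (μ ν : Measure ℝ) [SFinite ν] (u : ℝ) :
    ∫⁻ z, ENNReal.ofReal (Real.exp (u * z)) ∂(μ ∗ ν)
      = (∫⁻ z, ENNReal.ofReal (Real.exp (u * z)) ∂μ)
        * ∫⁻ z, ENNReal.ofReal (Real.exp (u * z)) ∂ν := by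
  rw [Measure.lintegral_conv (measurable_ofReal_exp_mul u)]
  simp_rw [mul_add, Real.exp_add, ENNReal.ofReal_mul (Real.exp_pos _).le]
  simp_rw [lintegral_const_mul _ (measurable_ofReal_exp_mul u)]
  rw [lintegral_mul_const _ (measurable_ofReal_exp_mul u)]

theorem IsAnalyticAffine.expMoment_mul_eq (hX : IsAnalyticAffine T 𝓕 X P) {s : ℝ≥0} (hs : s ≤ T)
    (u : ℝ) {x y x' y' : D} (h : (x : ℝ) + y = x' + y') :
    expMoment X P s u x * expMoment X P s u y = expMoment X P s u x' * expMoment X P s u y' := by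
  have := hX.isProbabilityMeasure_law hs
  simp only [hX.expMoment_eq_lintegral_law hs, ← lintegral_exp_conv, hX.law_conv_eq hs h]

theorem IsAnalyticAffine.expMoment_pos (hX : IsAnalyticAffine T 𝓕 X P) {s : ℝ≥0} (hs : s ≤ T)
    (u : ℝ) (x : D) : 0 < expMoment X P s u x := by
  have := hX.markovProcess.isMarkovKernel
  rw [expMoment, lintegral_pos_iff_support (hX.measurable_ofReal_exp hs u)]
  have : Function.support (fun ω => ENNReal.ofReal (Real.exp (u * (X s ω : ℝ)))) = univ := by
    ext ω; simp [Real.exp_pos]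
  rw [this]; simp

theorem expMoment_eq_of_exponents_spec {s : ℝ≥0} (h : Measurable fun ω => (X s ω : ℝ)) {u : ℝ}
    {x : D} {r : ℝ} (hr : expMoment X P s u x = ENNReal.ofReal (Real.exp r)) :
    ∫ ω, Real.exp (u * (X s ω : ℝ)) ∂(P x) = Real.exp r := by
  rw [integral_eq_lintegral_of_nonneg_ae (Eventually.of_forall fun _ => (Real.exp_pos _).le)
    (Real.measurable_exp.comp (h.const_mul u)).aestronglyMeasurable]
  rw [expMoment] at hr
  rw [hr, ENNReal.toReal_ofReal (Real.exp_pos _).le]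

theorem IsAnalyticAffine.exponents_eq_of_expMoment (hX : IsAnalyticAffine T 𝓕 X P) {s : ℝ≥0}
    (hs : s ≤ T) {u a b : ℝ}
    (h : ∀ x : D, expMoment X P s u x = ENNReal.ofReal (Real.exp (a + b * (x : ℝ)))) :
    phi X P s u = a ∧ psi X P s u = b := by
  have := exponents_eq hX.stateSpace X P s u (a, b) fun x =>
    expMoment_eq_of_exponents_spec (hX.measurable_coe hs) (h x)
  simp [phi, psi, this]

/-- A finite exponential moment is the exponential of an affine function of the starting point. -/
theorem IsAnalyticAffine.expMoment_eq (hX : IsAnalyticAffine T 𝓕 X P) {s : ℝ≥0} (hs : s ≤ T)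
    {u : ℝ} (hu : ∀ x : D, expMoment X P s u x ≠ ⊤) (x : D) :
    expMoment X P s u x
      = ENNReal.ofReal (Real.exp (phi X P s u + psi X P s u * (x : ℝ))) := by
  have h0 : (0 : ℝ) ∈ D := by rcases hX.stateSpace with h | h <;> simp [h]
  have hpos (x : D) : 0 < (expMoment X P s u x).toReal :=
    ENNReal.toReal_pos (hX.expMoment_pos hs u x).ne' (hu x)
  let f : D → ℝ := fun x => Real.log (expMoment X P s u x).toReal
  -- Subtracting the value at 0 turns the multiplicative identity for `x + y = z + 0` into
  -- additivity of the logarithm.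
  obtain ⟨b, hb⟩ := exists_linear_of_additive_measurable hX.stateSpace
    (fun x => f x - f ⟨0, h0⟩)
    (((Real.measurable_log.comp (hX.measurable_expMoment hs u).ennreal_toReal)).sub_const _)
    (fun x y z hxyz => by
      have h := congrArg (fun r => Real.log r.toReal)
        (hX.expMoment_mul_eq hs u (x := x) (y := y) (x' := z) (y' := ⟨0, h0⟩) (by simpa using hxyz))
      simp only [ENNReal.toReal_mul] at h
      rw [Real.log_mul (hpos _).ne' (hpos _).ne', Real.log_mul (hpos _).ne' (hpos _).ne'] at h
      simp only [f]
      linarith)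
  have key (x : D) : expMoment X P s u x
      = ENNReal.ofReal (Real.exp (f ⟨0, h0⟩ + b * (x : ℝ))) := by
    rw [← hb x, add_sub_cancel, Real.exp_log (hpos x), ENNReal.ofReal_toReal (hu x)]
  obtain ⟨h1, h2⟩ := hX.exponents_eq_of_expMoment hs key
  rw [h1, h2, key x]

/-- For `v ≤ u ≤ w`, `exp (u y)` is at most `exp (v y) + exp (w y)`, whatever the sign of `y`. -/
theorem IsAnalyticAffine.expMoment_ne_top (hX : IsAnalyticAffine T 𝓕 X P) {s : ℝ≥0} (hs : s ≤ T)
    {u v w : ℝ} (hv : ∀ x : D, expMoment X P s v x ≠ ⊤) (hw : ∀ x : D, expMoment X P s w x ≠ ⊤)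
    (hu : u ∈ Icc v w) (x : D) : expMoment X P s u x ≠ ⊤ := by
  refine ne_top_of_le_ne_top (ENNReal.add_ne_top.2 ⟨hv x, hw x⟩) ?_
  unfold expMoment
  rw [← lintegral_add_left (hX.measurable_ofReal_exp hs v)]
  refine lintegral_mono fun ω => ?_
  rw [← ENNReal.ofReal_add (Real.exp_pos _).le (Real.exp_pos _).le]
  refine ENNReal.ofReal_le_ofReal ?_
  rcases le_total 0 (X s ω : ℝ) with h | h
  · have := Real.exp_le_exp.2 (mul_le_mul_of_nonneg_right hu.2 h)
    linarith [Real.exp_pos (v * (X s ω : ℝ))]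
  · have := Real.exp_le_exp.2 (mul_le_mul_of_nonpos_right hu.1 h)
    linarith [Real.exp_pos (w * (X s ω : ℝ))]

/-- The real parameters with finite exponential moments of `X_s` for all starting points. -/
def momentDomain (X : ℝ≥0 → Ω → D) (P : Kernel D Ω) (s : ℝ≥0) : Set ℝ :=
  {u | ∀ x : D, expMoment X P s u x ≠ ⊤}

theorem mem_momentDomain_of_mem_momentSet {u : ℝ} (hu : (u : ℂ) ∈ momentSet T X P) {s : ℝ≥0}
    (hs : s ≤ T) : u ∈ momentDomain X P s := by
  intro x
  refine ne_top_of_le_ne_top (hu x).ne ?_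
  exact le_iSup₂_of_le (f := fun (s : ℝ≥0) (_ : s ∈ Iic T) =>
    ∫⁻ ω, ENNReal.ofReal (Real.exp ((u : ℂ).re * (X s ω : ℝ))) ∂(P x)) s hs le_rfl

/-! ### Convexity, monotonicity and the semiflow property of `ψ`. -/

/-- Hölder's inequality for `exp (v X_s)` and `exp (w X_s)` with weights `p` and `q`, after taking
logarithms. -/
theorem IsAnalyticAffine.log_expMoment_le (hX : IsAnalyticAffine T 𝓕 X P) {s : ℝ≥0} (hs : s ≤ T)
    {v w : ℝ} (hv : v ∈ momentDomain X P s) (hw : w ∈ momentDomain X P s) {p q : ℝ} (hp : 0 ≤ p)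
    (hq : 0 ≤ q) (hpq : p + q = 1) (huv : p * v + q * w ∈ momentDomain X P s) (x : D) :
    phi X P s (p * v + q * w) + psi X P s (p * v + q * w) * (x : ℝ)
      ≤ p * (phi X P s v + psi X P s v * x) + q * (phi X P s w + psi X P s w * x) := by
  have h := ENNReal.lintegral_mul_norm_pow_le (μ := P x)
    (hX.measurable_ofReal_exp hs v).aemeasurable
    (hX.measurable_ofReal_exp hs w).aemeasurable hp hq hpq
  have e (r k : ℝ) (hk : 0 ≤ k) : ENNReal.ofReal (Real.exp r) ^ k
      = ENNReal.ofReal (Real.exp (k * r)) := by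
    rw [ENNReal.ofReal_rpow_of_nonneg (Real.exp_pos _).le hk, ← Real.exp_mul, mul_comm]
  have h1 : ∀ ω, ENNReal.ofReal (Real.exp (v * (X s ω : ℝ))) ^ p
      * ENNReal.ofReal (Real.exp (w * (X s ω : ℝ))) ^ q
      = ENNReal.ofReal (Real.exp ((p * v + q * w) * (X s ω : ℝ))) := fun ω => by
    rw [e _ _ hp, e _ _ hq, ← ENNReal.ofReal_mul (Real.exp_pos _).le, ← Real.exp_add]
    congr 2; ring
  simp only [h1] at h
  change expMoment X P s (p * v + q * w) x ≤ expMoment X P s v x ^ p * expMoment X P s w x ^ q at h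
  rw [hX.expMoment_eq hs huv, hX.expMoment_eq hs hv, hX.expMoment_eq hs hw, e _ _ hp, e _ _ hq,
    ← ENNReal.ofReal_mul (Real.exp_pos _).le, ← Real.exp_add,
    ENNReal.ofReal_le_ofReal_iff (Real.exp_pos _).le, Real.exp_le_exp] at h
  exact h

theorem slope_le_of_forall_nonneg {a b a' b' : ℝ}
    (h : ∀ x : ℝ, 0 ≤ x → a + b * x ≤ a' + b' * x) : b ≤ b' := by
  by_contra! hlt
  -- At this point the excess of slope has gained `|a' - a| + 1`, more than the intercepts can
  -- compensate.
  have h1 := h ((|a' - a| + 1) / (b - b')) (div_nonneg (by positivity) (sub_pos.2 hlt).le)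
  have h2 : (b - b') * ((|a' - a| + 1) / (b - b')) = |a' - a| + 1 :=
    mul_div_cancel₀ _ (sub_pos.2 hlt).ne'
  linarith [le_abs_self (a' - a)]

theorem IsAnalyticAffine.mem_of_nonneg (hX : IsAnalyticAffine T 𝓕 X P) {x : ℝ} (hx : 0 ≤ x) :
    x ∈ D := by
  rcases hX.stateSpace with rfl | rfl <;> simp [hx]

/-- `ψ_s` is convex. -/
theorem IsAnalyticAffine.psi_convex (hX : IsAnalyticAffine T 𝓕 X P) {s : ℝ≥0} (hs : s ≤ T)
    {v w : ℝ} (hv : v ∈ momentDomain X P s) (hw : w ∈ momentDomain X P s) {p q : ℝ} (hp : 0 ≤ p)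
    (hq : 0 ≤ q) (hpq : p + q = 1) (huv : p * v + q * w ∈ momentDomain X P s) :
    psi X P s (p * v + q * w) ≤ p * psi X P s v + q * psi X P s w := by
  refine slope_le_of_forall_nonneg (a := phi X P s (p * v + q * w))
    (a' := p * phi X P s v + q * phi X P s w) fun x hx => ?_
  have := hX.log_expMoment_le hs hv hw hp hq hpq huv ⟨x, hX.mem_of_nonneg hx⟩
  simp only at this
  linarith

/-- On the state space `ℝ`, `ψ_s` is also concave. -/
theorem IsAnalyticAffine.psi_concave (hX : IsAnalyticAffine T 𝓕 X P) (hD : D = univ) {s : ℝ≥0}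
    (hs : s ≤ T) {v w : ℝ} (hv : v ∈ momentDomain X P s) (hw : w ∈ momentDomain X P s) {p q : ℝ}
    (hp : 0 ≤ p) (hq : 0 ≤ q) (hpq : p + q = 1) (huv : p * v + q * w ∈ momentDomain X P s) :
    p * psi X P s v + q * psi X P s w ≤ psi X P s (p * v + q * w) := by
  refine neg_le_neg_iff.1 (slope_le_of_forall_nonneg (a := phi X P s (p * v + q * w))
    (a' := p * phi X P s v + q * phi X P s w) fun x _ => ?_)
  -- Starting points tending to `-∞` reverse the comparison of slopes.
  have := hX.log_expMoment_le hs hv hw hp hq hpq huv ⟨-x, by simp [hD]⟩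
  simp only at this
  linarith

/-- On the state space `[0, ∞)`, `ψ_s` is monotone. -/
theorem IsAnalyticAffine.psi_mono (hX : IsAnalyticAffine T 𝓕 X P) (hD : D = Ici 0) {s : ℝ≥0}
    (hs : s ≤ T) {v w : ℝ} (hv : v ∈ momentDomain X P s) (hw : w ∈ momentDomain X P s)
    (hvw : v ≤ w) : psi X P s v ≤ psi X P s w := by
  refine slope_le_of_forall_nonneg (a := phi X P s v) (a' := phi X P s w) fun x hx => ?_
  have h : expMoment X P s v ⟨x, hX.mem_of_nonneg hx⟩
      ≤ expMoment X P s w ⟨x, hX.mem_of_nonneg hx⟩ :=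
    lintegral_mono fun ω => ENNReal.ofReal_le_ofReal <| Real.exp_le_exp.2 <|
      mul_le_mul_of_nonneg_right hvw (hD.le (X s ω).2)
  rwa [hX.expMoment_eq hs hv, hX.expMoment_eq hs hw,
    ENNReal.ofReal_le_ofReal_iff (Real.exp_pos _).le, Real.exp_le_exp] at h

theorem IsAnalyticAffine.psi_zero (hX : IsAnalyticAffine T 𝓕 X P) {s : ℝ≥0} (hs : s ≤ T) :
    psi X P s 0 = 0 := by
  have := hX.markovProcess.isMarkovKernel
  exact (hX.exponents_eq_of_expMoment hs (u := 0) (a := 0) fun x => by simp [expMoment]).2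

/-- Chapman–Kolmogorov for the laws, from integrating the conditional probabilities in the Markov
property. -/
theorem IsAnalyticAffine.map_add_eq_bind (hX : IsAnalyticAffine T 𝓕 X P) {s t : ℝ≥0}
    (hst : s + t ≤ T) (x : D) :
    (P x).map (X (s + t)) = ((P x).map (X s)).bind (P.map (X t)) := by
  have := hX.markovProcess.isMarkovKernel
  have hs : Measurable (X s) := hX.measurable (le_self_add.trans hst)
  have ht : Measurable (X t) := hX.measurable (le_add_self.trans hst)
  have hm : Measurable (X (s + t)) := hX.measurable hst
  ext A hA
  rw [Measure.map_apply hm hA, Measure.bind_apply hA (Kernel.measurable _).aemeasurable,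
    lintegral_map ((P.map (X t)).measurable_coe hA) hs]
  simp only [Kernel.map_apply' _ ht _ hA]
  have h := integral_congr_ae (hX.markovProcess.markov x s t hst A hA)
  rw [integral_condExp (𝓕.le s), integral_indicator_const _ (hm hA), smul_eq_mul, mul_one] at h
  simp only [measureReal_def] at h
  rw [integral_toReal (f := fun ω => P (X s ω) (X t ⁻¹' A))
    ((P.measurable_coe (ht hA)).comp hs).aemeasurable (Eventually.of_forall fun _ => measure_lt_top _ _)] at h
  refine (ENNReal.toReal_eq_toReal_iff' (measure_ne_top _ _) (ne_top_of_le_ne_top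
    ENNReal.one_ne_top ?_)).1 h
  calc ∫⁻ ω, P (X s ω) (X t ⁻¹' A) ∂(P x) ≤ ∫⁻ _, 1 ∂(P x) := lintegral_mono fun _ => prob_le_one
    _ = 1 := by simp

/-- The Chapman-Kolmogorov equation for exponential moments. -/
theorem IsAnalyticAffine.expMoment_add (hX : IsAnalyticAffine T 𝓕 X P) {s t : ℝ≥0}
    (hst : s + t ≤ T) (u : ℝ) (x : D) :
    expMoment X P (s + t) u x = ∫⁻ ω, expMoment X P t u (X s ω) ∂(P x) := by
  have hs : s ≤ T := le_self_add.trans hst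
  have ht : t ≤ T := le_add_self.trans hst
  have hf : Measurable fun y : D => ENNReal.ofReal (Real.exp (u * (y : ℝ))) :=
    (measurable_ofReal_exp_mul u).comp measurable_subtype_coe
  have h1 {r : ℝ≥0} (hr : r ≤ T) (y : D) : expMoment X P r u y
      = ∫⁻ z : D, ENNReal.ofReal (Real.exp (u * (z : ℝ))) ∂((P y).map (X r)) :=
    (lintegral_map hf (hX.measurable hr)).symm
  rw [h1 hst, hX.map_add_eq_bind hst,
    Measure.lintegral_bind (Kernel.measurable _).aemeasurable hf.aemeasurable,
    lintegral_map hf.lintegral_kernel (hX.measurable hs)]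
  simp only [Kernel.map_apply _ (hX.measurable ht), ← h1 ht]

/-- Conditioning at time `s` replaces `exp (u X_{s+t})` by `exp (φ_t(u) + ψ_t(u) X_s)`; comparing
the dependence on the start gives the semiflow equation. -/
theorem IsAnalyticAffine.psi_add (hX : IsAnalyticAffine T 𝓕 X P) {s t : ℝ≥0} (hst : s + t ≤ T)
    {u : ℝ} (hu : u ∈ momentDomain X P t) (hu' : u ∈ momentDomain X P (s + t)) :
    psi X P (s + t) u = psi X P s (psi X P t u) := by
  have hs : s ≤ T := le_self_add.trans hst
  have ht : t ≤ T := le_add_self.trans hst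
  have h (x : D) : expMoment X P (s + t) u x
      = ENNReal.ofReal (Real.exp (phi X P t u)) * expMoment X P s (psi X P t u) x := by
    rw [hX.expMoment_add hst, expMoment, ← lintegral_const_mul _ (hX.measurable_ofReal_exp hs _)]
    refine lintegral_congr fun ω => ?_
    rw [hX.expMoment_eq ht hu, Real.exp_add, ENNReal.ofReal_mul (Real.exp_pos _).le]
  -- Finiteness of the moment at time `s + t` forces that of the moment with parameter `ψ_t(u)` at
  -- time `s`.
  have hmem : psi X P t u ∈ momentDomain X P s := fun x htop => hu' x <| by
    rw [h, htop, ENNReal.mul_top (by simp [Real.exp_pos])]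
  refine (hX.exponents_eq_of_expMoment hst
    (a := phi X P t u + phi X P s (psi X P t u)) fun x => ?_).2
  rw [h, hX.expMoment_eq hs hmem, ← ENNReal.ofReal_mul (Real.exp_pos _).le, ← Real.exp_add,
    add_assoc]

/-! ### Dependence on the starting point and strict monotonicity of `ψ`. -/

/-- The law of `X_s` does not depend on the starting point. -/
def ForgetsStart (X : ℝ≥0 → Ω → D) (P : Kernel D Ω) (s : ℝ≥0) : Prop :=
  ∀ x y : D, law X P s x = law X P s y

theorem IsAnalyticAffine.psi_eq_zero (hX : IsAnalyticAffine T 𝓕 X P) {s : ℝ≥0} (hs : s ≤ T)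
    (h : ForgetsStart X P s) {u : ℝ} (hu : u ∈ momentDomain X P s) : psi X P s u = 0 := by
  have h0 := hX.expMoment_eq hs hu ⟨0, hX.mem_of_nonneg le_rfl⟩
  have h1 := hX.expMoment_eq hs hu ⟨1, hX.mem_of_nonneg zero_le_one⟩
  rw [hX.expMoment_eq_lintegral_law hs, h _ ⟨1, hX.mem_of_nonneg zero_le_one⟩,
    ← hX.expMoment_eq_lintegral_law hs, h1, ENNReal.ofReal_eq_ofReal_iff (Real.exp_pos _).le
    (Real.exp_pos _).le, Real.exp_eq_exp] at h0
  linarith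

theorem IsAnalyticAffine.mgf_law (hX : IsAnalyticAffine T 𝓕 X P) {s : ℝ≥0} (hs : s ≤ T) {u : ℝ}
    (hu : u ∈ momentDomain X P s) (x : D) :
    mgf id (law X P s x) u = Real.exp (phi X P s u + psi X P s u * (x : ℝ)) := by
  rw [law, mgf_id_map (hX.measurable_coe hs).aemeasurable]
  exact expMoment_eq_of_exponents_spec (hX.measurable_coe hs) (hX.expMoment_eq hs hu x)

theorem IsAnalyticAffine.mem_integrableExpSet (hX : IsAnalyticAffine T 𝓕 X P) {s : ℝ≥0}
    (hs : s ≤ T) {u : ℝ} (hu : u ∈ momentDomain X P s) (x : D) :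
    u ∈ integrableExpSet id (law X P s x) := by
  refine ⟨by fun_prop, ?_⟩
  have h := hu x
  rw [hX.expMoment_eq_lintegral_law hs] at h
  rw [hasFiniteIntegral_iff_ofReal (Eventually.of_forall fun _ => (Real.exp_pos _).le)]
  exact h.lt_top

/-- If `ψ_s` is constant on an interval then the law of `X_s` forgets the starting point. -/
theorem IsAnalyticAffine.forgetsStart_of_psi_eq (hX : IsAnalyticAffine T 𝓕 X P) {s : ℝ≥0}
    (hs : s ≤ T) {r : ℝ} (hr : 0 < r) (hdom : Icc (-r) r ⊆ momentDomain X P s) {v w c : ℝ}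
    (hv : -r ≤ v) (hvw : v < w) (hw : w ≤ r) (hc : ∀ u ∈ Ioo v w, psi X P s u = c) :
    ForgetsStart X P s := by
  intro x y
  have hprob := hX.isProbabilityMeasure_law hs
  let S : Set ℂ := Complex.re ⁻¹' Ioo (-r) r
  have hS (x : D) : AnalyticOnNhd ℂ (complexMGF id (law X P s x)) S := by
    refine analyticOnNhd_complexMGF.mono fun z hz => ?_
    refine interior_mono ?_ (by rw [isOpen_Ioo.interior_eq]; exact hz)
    exact fun u hu => hX.mem_integrableExpSet hs (hdom (Ioo_subset_Icc_self hu)) x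
  have hSpre : IsPreconnected S := ((convex_Ioo (-r) r).linear_preimage Complex.reLm).isPreconnected
  have hreal (t : ℝ) (ht : t ∈ Ioo v w) : complexMGF id (law X P s x) t
      = ((Real.exp (c * ((x : ℝ) - y)) : ℝ) : ℂ) * complexMGF id (law X P s y) t := by
    have htd : t ∈ momentDomain X P s := hdom ⟨hv.trans ht.1.le, ht.2.le.trans hw⟩
    rw [complexMGF_ofReal, complexMGF_ofReal, hX.mgf_law hs htd, hX.mgf_law hs htd, hc t ht,
      ← Complex.ofReal_mul, ← Real.exp_add]
    congr 2
    ring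
  obtain ⟨t, ht⟩ := exists_between hvw
  have hfreq : ∃ᶠ z in 𝓝[≠] (t : ℂ), complexMGF id (law X P s x) z
      = ((Real.exp (c * ((x : ℝ) - y)) : ℝ) : ℂ) * complexMGF id (law X P s y) z := by
    have ht' : Tendsto (fun a : ℝ => (a : ℂ)) (𝓝[≠] t) (𝓝[≠] (t : ℂ)) :=
      tendsto_nhdsWithin_of_tendsto_nhds_of_eventually_within _
        (Complex.continuous_ofReal.tendsto t |>.mono_left nhdsWithin_le_nhds)
        (eventually_mem_nhdsWithin.mono fun a ha => by simpa using ha)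
    refine ht'.frequently (Eventually.frequently ?_)
    exact eventually_nhdsWithin_of_eventually_nhds
      (eventually_of_mem (Ioo_mem_nhds ht.1 ht.2) hreal)
  -- The identity theorem carries the proportionality from a real interval to the whole strip. Its
  -- value at 0 makes the constant 1, and the imaginary axis then gives equal characteristic
  -- functions.
  have heq := (hS x).eqOn_of_preconnected_of_frequently_eq
    (analyticOnNhd_const.mul (hS y)) hSpre (z₀ := (t : ℂ))
    (by simpa [S] using ⟨hv.trans_lt ht.1, ht.2.trans_le hw⟩) hfreq
  have h0 := heq (x := 0) (by simpa [S] using hr)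
  have hz (x : D) : complexMGF id (law X P s x) 0 = 1 := by simp [complexMGF]
  simp only [hz, mul_one] at h0
  refine Measure.ext_of_charFun (funext fun a => ?_)
  have h1 := heq (x := a * Complex.I) (by simpa [S] using hr)
  simpa [← h0, complexMGF_id_mul_I] using h1

/-- On the state space `ℝ` the exponent is both convex and concave, hence affine, and it vanishes at
0. -/
theorem IsAnalyticAffine.psi_linear (hX : IsAnalyticAffine T 𝓕 X P) (hD : D = univ) {s : ℝ≥0}
    (hs : s ≤ T) {r : ℝ} (hr : 0 < r) (hdom : Icc (-r) r ⊆ momentDomain X P s) {u : ℝ}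
    (hu : u ∈ Icc (-r) r) : psi X P s u = psi X P s r / r * u := by
  have hr' : r ∈ Icc (-r) r := ⟨by linarith, le_rfl⟩
  have hnr : -r ∈ Icc (-r) r := ⟨le_rfl, by linarith⟩
  have key {u : ℝ} (hu : u ∈ Icc (-r) r) : psi X P s u
      = (1 + u / r) / 2 * psi X P s r + (1 - u / r) / 2 * psi X P s (-r) := by
    have h1 : (1 + u / r) / 2 * r + (1 - u / r) / 2 * -r = u := by field_simp; ring
    have hp : 0 ≤ (1 + u / r) / 2 := by
      have : -1 ≤ u / r := by rw [le_div_iff₀ hr]; linarith [hu.1]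
      linarith
    have hq : 0 ≤ (1 - u / r) / 2 := by
      have : u / r ≤ 1 := by rw [div_le_iff₀ hr]; linarith [hu.2]
      linarith
    have hm : (1 + u / r) / 2 * r + (1 - u / r) / 2 * -r ∈ momentDomain X P s := by
      rw [h1]; exact hdom hu
    have := (hX.psi_convex hs (hdom hr') (hdom hnr) hp hq (by ring) hm).antisymm
      (hX.psi_concave hD hs (hdom hr') (hdom hnr) hp hq (by ring) hm)
    rwa [h1] at this
  have h0 := key (u := 0) ⟨by linarith, hr.le⟩
  rw [hX.psi_zero hs] at h0
  have h1 : psi X P s (-r) = -psi X P s r := by simp at h0; linarith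
  rw [key hu, h1]
  field_simp
  ring

/-- `ψ_s` is strictly increasing on `[-r, r]` unless the law of `X_s` forgets the starting point. -/
theorem IsAnalyticAffine.psi_strictMonoOn_of_not_forgetsStart (hX : IsAnalyticAffine T 𝓕 X P)
    {r : ℝ} (hr : 0 < r) (hdom : ∀ s ≤ T, Icc (-r) r ⊆ momentDomain X P s) {s : ℝ≥0} (hs : s ≤ T)
    (h : ¬ ForgetsStart X P s) : StrictMonoOn (psi X P s) (Icc (-r) r) := by
  rcases hX.stateSpace with hD | hD
  · have hlin (s : ℝ≥0) (hs : s ≤ T) {u : ℝ} (hu : u ∈ Icc (-r) r) :=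
      hX.psi_linear hD hs hr (hdom s hs) hu
    have hne : psi X P s r / r ≠ 0 := fun h0 => h <|
      hX.forgetsStart_of_psi_eq hs hr (hdom s hs) le_rfl (by linarith : -r < r) le_rfl
        (c := 0) fun u hu => by rw [hlin s hs (Ioo_subset_Icc_self hu), h0, zero_mul]
    have hs2 : s / 2 ≤ T := (half_le_self zero_le).trans hs
    set b := psi X P (s / 2) r / r with hb
    -- This factor scales `r` so that both the point and its image under multiplication by `b` stay
    -- in `[-r, r]`, where the semiflow equation can be evaluated linearly.
    have hε : 0 < 1 / (1 + |b|) := by positivity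
    have hε1 : 1 / (1 + |b|) ≤ 1 := by
      rw [div_le_one (by positivity)]; linarith [abs_nonneg b]
    have hεr : 1 / (1 + |b|) * r ≤ r := mul_le_of_le_one_left hr.le hε1
    have hεr0 : 0 < 1 / (1 + |b|) * r := mul_pos hε hr
    have hu : 1 / (1 + |b|) * r ∈ Icc (-r) r := ⟨by linarith, hεr⟩
    have hbu : b * (1 / (1 + |b|) * r) ∈ Icc (-r) r := by
      rw [mem_Icc, ← abs_le, abs_mul, abs_of_pos hεr0, ← mul_assoc]
      refine mul_le_of_le_one_left hr.le ?_
      rw [mul_one_div, div_le_one (by positivity)]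
      linarith
    have hcomp := hX.psi_add (s := s / 2) (t := s / 2) ((add_halves s).le.trans hs)
      (hdom _ hs2 hu) (hdom _ ((add_halves s).le.trans hs) hu)
    rw [add_halves, hlin s hs hu, hlin _ hs2 hu, hlin _ hs2 hbu, ← hb, ← mul_assoc b b] at hcomp
    -- The slope at time `s` is the square of the slope at time `s / 2`, so being nonzero it is
    -- positive.
    have hsq := mul_right_cancel₀ hεr0.ne' hcomp
    have hpos : 0 < psi X P s r / r := lt_of_le_of_ne (hsq ▸ mul_self_nonneg b) hne.symm
    intro v hv w hw hvw
    rw [hlin s hs hv, hlin s hs hw]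
    exact mul_lt_mul_of_pos_left hvw hpos
  · have hmono : MonotoneOn (psi X P s) (Icc (-r) r) := fun v hv w hw hvw =>
      hX.psi_mono hD hs (hdom s hs hv) (hdom s hs hw) hvw
    intro v hv w hw hvw
    refine lt_of_le_of_ne (hmono hv hw hvw.le) fun heq => h ?_
    refine hX.forgetsStart_of_psi_eq hs hr (hdom s hs) hv.1 hvw hw.2 (c := psi X P s v)
      fun u hu => ?_
    have hu' : u ∈ Icc (-r) r := ⟨hv.1.trans hu.1.le, hu.2.le.trans hw.2⟩
    exact ((hmono hu' hw hu.2.le).trans_eq heq.symm).antisymm (hmono hv hu' hu.1.le)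

/-- Otherwise `ψ_{s/2}` is strictly increasing with value 0 at 0, so its second iterate is positive
at small `u > 0`; but that iterate is `ψ_s(u) = 0`. -/
theorem IsAnalyticAffine.forgetsStart_half (hX : IsAnalyticAffine T 𝓕 X P)
    {r : ℝ} (hr : 0 < r) (hdom : ∀ s ≤ T, Icc (-r) r ⊆ momentDomain X P s) {s : ℝ≥0} (hs : s ≤ T)
    (h : ForgetsStart X P s) : ForgetsStart X P (s / 2) := by
  by_contra hn
  have hs2 : s / 2 ≤ T := (half_le_self zero_le).trans hs
  have hmono := hX.psi_strictMonoOn_of_not_forgetsStart hr hdom hs2 hn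
  have h0 : (0 : ℝ) ∈ Icc (-r) r := ⟨by linarith, hr.le⟩
  have hr' : r ∈ Icc (-r) r := ⟨by linarith, le_rfl⟩
  have hz := hX.psi_zero hs2
  set k := psi X P (s / 2) r with hk
  have hkpos : 0 < k := hz ▸ hmono h0 hr' hr
  -- By convexity `ψ_{s/2}(ε r) ≤ ε k`, and `ε = r / (r + k)` makes this at most `r`, so the second
  -- application stays in `[-r, r]`.
  have hε : 0 < r / (r + k) := by positivity
  have hε1 : r / (r + k) ≤ 1 := by rw [div_le_one (by positivity)]; linarith
  have hu0 : 0 < r / (r + k) * r := mul_pos hε hr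
  have hu : r / (r + k) * r ∈ Icc (-r) r :=
    ⟨by linarith, mul_le_of_le_one_left hr.le hε1⟩
  have hconv := hX.psi_convex hs2 (hdom _ hs2 hr') (hdom _ hs2 h0) hε.le (sub_nonneg.2 hε1)
    (by ring) (by simpa using hdom _ hs2 hu)
  rw [mul_zero, add_zero, hz, mul_zero, add_zero, ← hk] at hconv
  have hle : r / (r + k) * k ≤ r := by
    rw [div_mul_eq_mul_div, div_le_iff₀ (by positivity)]
    nlinarith
  have hpos : 0 < psi X P (s / 2) (r / (r + k) * r) := hz ▸ hmono h0 hu hu0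
  have hcomp := hX.psi_add (s := s / 2) (t := s / 2) ((add_halves s).le.trans hs)
    (hdom _ hs2 hu) (hdom _ ((add_halves s).le.trans hs) hu)
  rw [add_halves, hX.psi_eq_zero hs h (hdom s hs hu)] at hcomp
  have := hmono h0 ⟨by linarith, hconv.trans hle⟩ hpos
  rw [hz, ← hcomp] at this
  exact lt_irrefl _ this

theorem IsAnalyticAffine.tendsto_law_compl_ball (hX : IsAnalyticAffine T 𝓕 X P) {s : ℕ → ℝ≥0}
    (hs : ∀ n, s n ≤ T) (hs0 : Tendsto s atTop (𝓝 0)) (x : D) {ε : ℝ} (hε : 0 < ε) :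
    Tendsto (fun n => law X P (s n) x {y | ε ≤ |y - x|}) atTop (𝓝 0) := by
  have h := (hX.stochasticallyContinuous x 0 zero_le (ENNReal.ofReal ε)
    (ENNReal.ofReal_pos.2 hε)).comp (tendsto_nhdsWithin_of_tendsto_nhds_of_eventually_within _ hs0
      (Eventually.of_forall hs))
  refine h.congr fun n => ?_
  rw [law, Measure.map_apply (hX.measurable_coe (hs n))
    (measurableSet_le measurable_const (by fun_prop))]
  refine measure_congr ?_
  filter_upwards [hX.markovProcess.initial x] with ω hω
  refine propext ?_
  change ENNReal.ofReal ε ≤ edist (X (s n) ω) (X 0 ω) ↔ ε ≤ |(X (s n) ω : ℝ) - x|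
  rw [hω, edist_dist, ENNReal.ofReal_le_ofReal_iff dist_nonneg, Subtype.dist_eq, Real.dist_eq]

/-- Halving repeatedly would give small times at which the laws started from 0 and 1 agree, though
they concentrate near 0 and near 1 respectively. -/
theorem IsAnalyticAffine.not_forgetsStart (hX : IsAnalyticAffine T 𝓕 X P)
    {r : ℝ} (hr : 0 < r) (hdom : ∀ s ≤ T, Icc (-r) r ⊆ momentDomain X P s) {s : ℝ≥0}
    (hs : s ≤ T) : ¬ ForgetsStart X P s := by
  intro h
  let σ : ℕ → ℝ≥0 := fun n => s / 2 ^ n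
  have hσ (n : ℕ) : σ n ≤ T := (div_le_self zero_le (one_le_pow₀ one_le_two)).trans hs
  have hσ0 : Tendsto σ atTop (𝓝 0) := by
    have := (tendsto_pow_atTop_nhds_zero_of_lt_one (r := (2⁻¹ : ℝ≥0)) zero_le
      (by norm_num)).const_mul s
    simpa [σ, div_eq_mul_inv] using this
  have hf (n : ℕ) : ForgetsStart X P (σ n) := by
    induction n with
    | zero => simpa [σ] using h
    | succ n ih =>
      have := hX.forgetsStart_half hr hdom (hσ n) ih
      rwa [show σ n / 2 = σ (n + 1) by simp only [σ, pow_succ, div_div]] at this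
  let x₀ : D := ⟨0, hX.mem_of_nonneg le_rfl⟩
  let x₁ : D := ⟨1, hX.mem_of_nonneg zero_le_one⟩
  have hlim := (hX.tendsto_law_compl_ball hσ hσ0 x₀ one_half_pos).add
    (hX.tendsto_law_compl_ball hσ hσ0 x₁ one_half_pos)
  rw [add_zero] at hlim
  -- The open balls of radius 1/2 around 0 and 1 are disjoint, so their complements cover `ℝ` and a
  -- common law gives them total mass at least 1.
  have hge (n : ℕ) : 1 ≤ law X P (σ n) x₀ {y | 1 / 2 ≤ |y - x₀|}
      + law X P (σ n) x₁ {y | 1 / 2 ≤ |y - x₁|} := by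
    have := hX.isProbabilityMeasure_law (hσ n) x₀
    rw [hf n x₁ x₀]
    refine le_trans ?_ (measure_union_le _ _)
    rw [show {y : ℝ | 1 / 2 ≤ |y - x₀|} ∪ {y : ℝ | 1 / 2 ≤ |y - x₁|} = univ from ?_]
    · simp
    · refine eq_univ_of_forall fun y => ?_
      simp only [x₀, x₁, mem_union, mem_ofPred_eq, sub_zero]
      by_contra! hy
      linarith [le_abs_self y, neg_abs_le (y - 1)]
  exact absurd (ge_of_tendsto' hlim hge) (by simp)

theorem IsAnalyticAffine.psi_strictMonoOn (hX : IsAnalyticAffine T 𝓕 X P)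
    {r : ℝ} (hr : 0 < r) (hr₁ : (r : ℂ) ∈ momentSet T X P) (hr₂ : -(r : ℂ) ∈ momentSet T X P)
    {s : ℝ≥0} (hs : s ≤ T) : StrictMonoOn (psi X P s) (Icc (-r) r) := by
  have hdom : ∀ s ≤ T, Icc (-r) r ⊆ momentDomain X P s := fun s hs u hu =>
    hX.expMoment_ne_top hs
      (mem_momentDomain_of_mem_momentSet (u := -r) (by rwa [Complex.ofReal_neg]) hs)
      (mem_momentDomain_of_mem_momentSet hr₁ hs) hu
  exact hX.psi_strictMonoOn_of_not_forgetsStart hr hdom hs (hX.not_forgetsStart hr hdom hs)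

end

end AffineLibor

/-! ### Combination of the two halves. -/

theorem mainTheorem2 {Ω : Type*} {mΩ : MeasurableSpace Ω} {D : Set ℝ} (T : ℝ≥0)
    (𝓕 : Filtration ℝ≥0 mΩ) (X : ℝ≥0 → Ω → D) (P : Kernel D Ω)
    (hX : AffineLibor.IsAnalyticAffine T 𝓕 X P)
    (t : ℝ≥0) (ht : t ≤ T) (n : ℕ) (u₀ : ℝ) (u c : Fin n → ℝ)
    (hu₀ : (u₀ : ℂ) ∈ AffineLibor.momentSet T X P ∧ -(u₀ : ℂ) ∈ AffineLibor.momentSet T X P)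
    (hu : ∀ i, (u i : ℂ) ∈ AffineLibor.momentSet T X P ∧ -(u i : ℂ) ∈ AffineLibor.momentSet T X P)
    (hle : ∀ i, 0 ≤ u i ∧ u i ≤ u₀) (hlt : ∃ i, u i < u₀) (hc : ∀ i, 0 < c i) :
    ∃ ξ : ℝ,
      (∀ x, x ≠ ξ → AffineLibor.g T X P t u₀ u c x < AffineLibor.g T X P t u₀ u c ξ) ∧
      StrictMonoOn (AffineLibor.g T X P t u₀ u c) (Set.Iic ξ) ∧
      StrictAntiOn (AffineLibor.g T X P t u₀ u c) (Set.Ici ξ) ∧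
      Tendsto (AffineLibor.g T X P t u₀ u c) atBot (𝓝 (∑ i with u i = u₀, c i)) ∧
      Tendsto (AffineLibor.g T X P t u₀ u c) atTop (𝓝 (∑ i with u i = u₀, c i)) := by
  obtain ⟨i₀, hi₀⟩ := hlt
  have hpos : 0 < u₀ := (hle i₀).1.trans_lt hi₀
  have hmono := hX.psi_strictMonoOn hpos hu₀.1 hu₀.2 (tsub_le_self : T - t ≤ T)
  obtain ⟨⟨ξ, hξ₁, hξ₂⟩, hbot, htop⟩ := AffineLibor.exists_unimodal_sum_expPair_div
    (Finset.univ.filter fun i => ¬ u i = u₀) ⟨i₀, by simp [hi₀.ne]⟩ c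
    (fun i => AffineLibor.phi X P (T - t) (u i)) (fun i => AffineLibor.psi X P (T - t) (u i))
    (fun i => AffineLibor.phi X P (T - t) (-u i)) (fun i => AffineLibor.psi X P (T - t) (-u i))
    (AffineLibor.phi X P (T - t) u₀) (AffineLibor.psi X P (T - t) u₀)
    (AffineLibor.phi X P (T - t) (-u₀)) (AffineLibor.psi X P (T - t) (-u₀))
    (fun i _ => hc i)
    (fun i hi => hmono ⟨le_rfl, by linarith⟩ ⟨by linarith [(hle i).2], by linarith [(hle i).1]⟩
      (neg_lt_neg (lt_of_le_of_ne (hle i).2 (Finset.mem_filter.1 hi).2)))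
    (fun i _ => hmono.monotoneOn ⟨by linarith [(hle i).2], by linarith [(hle i).1]⟩
      ⟨by linarith [(hle i).1], (hle i).2⟩ (by linarith [(hle i).1]))
    (fun i hi => hmono ⟨by linarith [(hle i).1], (hle i).2⟩ ⟨by linarith, le_rfl⟩
      (lt_of_le_of_ne (hle i).2 (Finset.mem_filter.1 hi).2))
  -- Terms with `uᵢ = u₀` are identically `cᵢ`; they shift the unimodal remainder and supply the
  -- limit.
  have hg : AffineLibor.g T X P t u₀ u c = fun x => (∑ i with u i = u₀, c i) + ∑ i with ¬ u i = u₀, c i *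
      (AffineLibor.M T X P t (u i) x / AffineLibor.M T X P t u₀ x) := by
    funext x
    rw [AffineLibor.g, ← Finset.sum_filter_add_sum_filter_not _ fun i => u i = u₀]
    refine congrArg₂ (· + ·) (Finset.sum_congr rfl fun i hi => ?_) rfl
    rw [(Finset.mem_filter.1 hi).2, div_self, mul_one]
    exact (AffineLibor.expPair_pos _ _ _ _ x).ne'
  rw [hg]
  refine ⟨ξ, fun x hx => ?_, hξ₁.const_add _, hξ₂.const_add _, ?_, ?_⟩
  · refine add_lt_add_right ?_ _
    rcases hx.lt_or_gt with h | h
    · exact hξ₁ h.le self_mem_Iic h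
    · exact hξ₂ self_mem_Ici h.le h
  · have h := hbot.const_add (∑ i with u i = u₀, c i)
    rwa [add_zero] at h
  · have h := htop.const_add (∑ i with u i = u₀, c i)
    rwa [add_zero] at h
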